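/- **Setting.** Let $0\le s\le d$ be integers, $f_0:[0,1]^d\to\mathbb R$ coordinatewise nondecreasing, and $\boldsymbol x_0\in(0,1)^d$. For each $k$ let $\beta_k$ be the order of the first non-zero derivative of $f_0$ at $\boldsymbol x_0$ along the $k$-th coordinate, $\beta_k=\min\{l\ge1:\partial_k^lf_0(\boldsymbol x_0)\ne0\}$ ($\beta_k=\infty$ if there is none), and suppose that $\beta_k<\infty$ for $k\le s$ and $\beta_k=\infty$ for $k>s$. Let $g$ be a probability density on $[0,1]^d$ with $0<a_1\le g\le a_2<\infty$ there for some constants $a_1,a_2$, continuous (as a function on $[0,1]^d$) in a neighbourhood of $\{(x_{0,1},\dots,x_{0,s},x_{s+1},\dots,x_d): x_k\in[0,1]\text{ for }k>s\}$, and let $\sigma_0>0$. For $\boldsymbol u,\boldsymbol v\in\mathbb R_{\ge0}^d$ put $$D_s(\boldsymbol u,\boldsymbol v)=\int_{x_k\in[x_{0,k}-u_k,\,x_{0,k}+v_k]\cap[0,1],\ s<k\le d} g(x_{0,1},\dots,x_{0,s},x_{s+1},\dots,x_d)\,dx_{s+1}\cdots dx_d ,\qquad D_d=g(\boldsymbol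 x_0).$$ Let $H_1,H_2$ be independent centered Gaussian processes on $\mathbb R_{\ge0}^d\times\mathbb R_{\ge0}^d$ with almost surely continuous sample paths and covariance kernel $$\prod_{k=1}^s(u_k\wedge u_k'+v_k\wedge v_k')\;D_s(\boldsymbol u\wedge\boldsymbol u',\boldsymbol v\wedge\boldsymbol v').$$ Below, $\sup_{\boldsymbol u\succeq\boldsymbol 0}\inf_{\boldsymbol v\succeq\boldsymbol 0}$ and $\inf_{\boldsymbol v\succeq\boldsymbol 0}\sup_{\boldsymbol u\succeq\boldsymbol 0}$ are taken in $[-\infty,\infty]$, over the pairs $(\boldsymbol u,\boldsymbol v)$ with $u_k+v_k>0$ for all $k\le d$ (exactly those at which no denominator vanishes), and $=_d$ is equality in distribution. **Proposition.** Suppose that $$L^*:=\Big\{\boldsymbol l\in\mathbb Z_{\ge0}^d:\ \sum_{k=1}^s l_k/\beta_k=1,\ l_k=0\text{ for }k>s\Big\}=\{\beta_k\boldsymbol e_k:1\le k\le s\},$$ where $\boldsymbol e_k$ is the $k$-th standard unit vector. Then $$\sup_{\boldsymbol u\succeq\boldsymbol 0}\inf_{\boldsymbol v\succeq\boldsymbol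 0}\Big\{\frac{\sigma_0H_1(\boldsymbol u,\boldsymbol v)}{\prod_{k=1}^s(u_k+v_k)D_s(\boldsymbol u,\boldsymbol v)}+\frac{\sigma_0H_2(\boldsymbol u,\boldsymbol v)}{\prod_{k=1}^s(u_k+v_k)D_s(\boldsymbol u,\boldsymbol v)}+\sum_{k=1}^s\frac{\partial_k^{\beta_k}f_0(\boldsymbol x_0)}{(\beta_k+1)!}\cdot\frac{v_k^{\beta_k+1}-(-u_k)^{\beta_k+1}}{u_k+v_k}\Big\}$$ $$=_d\ A_{\boldsymbol\beta}\cdot\sup_{\boldsymbol u\succeq\boldsymbol 0}\inf_{\boldsymbol v\succeq\boldsymbol 0}\Big\{\frac{H_1(\boldsymbol u,\boldsymbol v)}{\prod_{k=1}^s(u_k+v_k)D_s(\boldsymbol u,\boldsymbol v)}+\frac{H_2(\boldsymbol u,\boldsymbol v)}{\prod_{k=1}^s(u_k+v_k)D_s(\boldsymbol u,\boldsymbol v)}+\sum_{k=1}^s\frac{v_k^{\beta_k+1}-(-u_k)^{\beta_k+1}}{u_k+v_k}\Big\},$$ where $$A_{\boldsymbol\beta}=\Big(\sigma_0^2\prod_{k=1}^s\Big(\frac{\partial_k^{\beta_k}f_0(\boldsymbol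 x_0)}{(\beta_k+1)!}\Big)^{1/\beta_k}\Big)^{1/(2+\sum_{k=1}^s\beta_k^{-1})}.$$ If moreover $s=d$, then both sides are also equal in distribution to $$\tilde A_{\boldsymbol\beta}\cdot\sup_{\boldsymbol u\succeq\boldsymbol 0}\inf_{\boldsymbol v\succeq\boldsymbol 0}\Big\{\frac{\tilde H_1(\boldsymbol u,\boldsymbol v)}{\prod_{k=1}^d(u_k+v_k)}+\frac{\tilde H_2(\boldsymbol u,\boldsymbol v)}{\prod_{k=1}^d(u_k+v_k)}+\sum_{k=1}^d\frac{v_k^{\beta_k+1}-(-u_k)^{\beta_k+1}}{u_k+v_k}\Big\},$$ where $$\tilde A_{\boldsymbol\beta}=\Big(\frac{\sigma_0^2}{g(\boldsymbol x_0)}\prod_{k=1}^d\Big(\frac{\partial_k^{\beta_k}f_0(\boldsymbol x_0)}{(\beta_k+1)!}\Big)^{1/\beta_k}\Big)^{1/(2+\sum_{k=1}^d\beta_k^{-1})}$$ and $\tilde H_1,\tilde H_2$ are any independent centered Gaussian processes on $\mathbb R_{\ge0}^d\times\mathbb R_{\ge0}^d$ (possibly on another probability space) with almost surely continuous sample paths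 and covariance kernel $\prod_{k=1}^d(u_k\wedge u_k'+v_k\wedge v_k')$. The same conclusions hold with $\inf_{\boldsymbol v\succeq\boldsymbol 0}\sup_{\boldsymbol u\succeq\boldsymbol 0}$ in place of $\sup_{\boldsymbol u\succeq\boldsymbol 0}\inf_{\boldsymbol v\succeq\boldsymbol 0}$ throughout. -/

import Mathlib

open MeasureTheory ProbabilityTheory Set Filter Topology
open scoped NNReal ENNReal

noncomputable section

/-! ### The regression function near the point of interest -/

/-- The section `t ↦ f (x₁, …, x_{k-1}, t, x_{k+1}, …, x_d)` of `f` through `x` along the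
coordinate `k`. -/
def coordSection {d : ℕ} (f : (Fin d → ℝ) → ℝ) (x : Fin d → ℝ) (k : Fin d) : ℝ → ℝ :=
  fun t => f (Function.update x k t)

/-- The partial derivative `∂ₖⁿ f (x)`. -/
def partialDerivAt {d : ℕ} (f : (Fin d → ℝ) → ℝ) (x : Fin d → ℝ) (k : Fin d) (n : ℕ) : ℝ :=
  iteratedDeriv n (coordSection f x k) (x k)

/-- `∂ₖⁿ f (x)` exists: the derivatives of the section of order less than `n` exist around `x k`
and the one of order `n` exists at `x k`. -/
def HasPartialDerivAt {d : ℕ} (f : (Fin d → ℝ) → ℝ) (x : Fin d → ℝ) (k : Fin d) (n : ℕ) : Prop :=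
  ∀ m < n, DifferentiableAt ℝ (iteratedDeriv m (coordSection f x k)) (x k) ∧
    (m + 1 < n →
      ∀ᶠ t in 𝓝 (x k), DifferentiableAt ℝ (iteratedDeriv m (coordSection f x k)) t)

/-- The order of the first non-zero derivative of `f` at `x` along the coordinate `k`
(`⊤` if there is none). -/
def firstDerivOrder {d : ℕ} (f : (Fin d → ℝ) → ℝ) (x : Fin d → ℝ) (k : Fin d) : ℕ∞ :=
  ⨅ (n : ℕ) (_ : 1 ≤ n ∧ partialDerivAt f x k n ≠ 0), (n : ℕ∞)

/-- The coordinates `1 ≤ k ≤ s`; they are numbered from `0` here, so that `k ≤ s` reads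
`(k : ℕ) < s`. -/
def firstCoords (d s : ℕ) : Finset (Fin d) :=
  Finset.univ.filter fun k => (k : ℕ) < s

/-- The set `L*` of the multi-indices `l` with `∑_{k ≤ s} l_k / β_k = 1` and `l_k = 0` for
`k > s`. -/
def multiIndexLstar {d : ℕ} (s : ℕ) (β : Fin d → ℕ) : Set (Fin d → ℕ) :=
  {l | (∑ k ∈ firstCoords d s, (l k : ℝ) / (β k : ℝ)) = 1 ∧
    ∀ k : Fin d, s ≤ (k : ℕ) → l k = 0}

/-! ### The density of the predictor -/

/-- `g` is a probability density on `[0,1]^d`, bounded away from `0` and `∞` there, and continuous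
(as a function on the cube) in a neighbourhood of the set of the points of the cube whose first
`s` coordinates are those of `x₀`. -/
structure IsPredictorDensity {d : ℕ} (g : (Fin d → ℝ) → ℝ) (x₀ : Fin d → ℝ) (s : ℕ) : Prop where
  integral_eq_one : ∫ x in Icc (0 : Fin d → ℝ) 1, g x = 1
  bounded : ∃ a₁ a₂ : ℝ, 0 < a₁ ∧ ∀ x ∈ Icc (0 : Fin d → ℝ) 1, a₁ ≤ g x ∧ g x ≤ a₂
  continuous : ∃ V : Set (Fin d → ℝ), IsOpen V ∧
    {x | (∀ k : Fin d, (k : ℕ) < s → x k = x₀ k) ∧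
      ∀ k : Fin d, s ≤ (k : ℕ) → x k ∈ Icc (0 : ℝ) 1} ⊆ V ∧
    ContinuousOn g (V ∩ Icc (0 : Fin d → ℝ) 1)

/-- `D_s(u, v)`: the integral of `g (x₀₁, …, x₀ₛ, x_{s+1}, …, x_d)` over
`x_k ∈ [x₀ₖ - u_k, x₀ₖ + v_k] ∩ [0,1]`, `s < k ≤ d`.  For `s = d` no variable is integrated and
the value is `g x₀`, since the volume of `ι → ℝ` for empty `ι` is the unit mass at its point. -/
def sliceMass {d : ℕ} (g : (Fin d → ℝ) → ℝ) (x₀ : Fin d → ℝ) (s : ℕ)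
    (u v : Fin d → ℝ≥0) : ℝ :=
  ∫ y in {y : {k : Fin d // s ≤ (k : ℕ)} → ℝ |
      ∀ k, y k ∈ Icc (x₀ k.1 - u k.1) (x₀ k.1 + v k.1) ∩ Icc (0 : ℝ) 1},
    g (fun k => if h : s ≤ (k : ℕ) then y ⟨k, h⟩ else x₀ k)

/-! ### The Gaussian processes -/

/-- The index set `ℝ_{≥0}^d × ℝ_{≥0}^d` of the pairs `(u, v)`. -/
abbrev BoxIndex (d : ℕ) : Type := (Fin d → ℝ≥0) × (Fin d → ℝ≥0)

/-- The kernel `∏_{k ≤ s} (u_k ∧ u'_k + v_k ∧ v'_k) · D_s(u ∧ u', v ∧ v')`. -/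
def sliceKernel {d : ℕ} (g : (Fin d → ℝ) → ℝ) (x₀ : Fin d → ℝ) (s : ℕ)
    (p q : BoxIndex d) : ℝ :=
  (∏ k ∈ firstCoords d s, ((min (p.1 k) (q.1 k) : ℝ) + (min (p.2 k) (q.2 k) : ℝ))) *
    sliceMass g x₀ s (p.1 ⊓ q.1) (p.2 ⊓ q.2)

/-- The kernel `∏_{k ≤ d} (u_k ∧ u'_k + v_k ∧ v'_k)`. -/
def standardKernel {d : ℕ} (p q : BoxIndex d) : ℝ :=
  ∏ k : Fin d, ((min (p.1 k) (q.1 k) : ℝ) + (min (p.2 k) (q.2 k) : ℝ))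

/-- `H` is a centered Gaussian process with covariance kernel `K` and almost surely continuous
sample paths. -/
structure IsCenteredGaussianWithKernel {d : ℕ} {Ω : Type*} [MeasurableSpace Ω]
    (H : BoxIndex d → Ω → ℝ) (K : BoxIndex d → BoxIndex d → ℝ) (μ : Measure Ω) : Prop where
  gaussian : IsGaussianProcess H μ
  mean_zero : ∀ p, ∫ ω, H p ω ∂μ = 0
  covariance_eq : ∀ p q, covariance (H p) (H q) μ = K p q
  continuous_paths : ∀ᵐ ω ∂μ, Continuous fun p => H p ω

/-- `H₁` and `H₂` are independent as processes. -/
def IndepProcesses {d : ℕ} {Ω : Type*} [MeasurableSpace Ω]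
    (H₁ H₂ : BoxIndex d → Ω → ℝ) (μ : Measure Ω) : Prop :=
  IndepFun (fun ω p => H₁ p ω) (fun ω p => H₂ p ω) μ

/-! ### The functionals -/

/-- The field
`σ h₁(u,v) / (∏_{k ≤ s} (u_k + v_k) D(u,v)) + σ h₂(u,v) / (∏_{k ≤ s} (u_k + v_k) D(u,v))
  + ∑_{k ≤ s} a_k (v_k^{β_k+1} - (-u_k)^{β_k+1}) / (u_k + v_k)`. -/
def driftedField {d : ℕ} (s : ℕ) (β : Fin d → ℕ) (σ : ℝ) (a : Fin d → ℝ)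
    (D : (Fin d → ℝ≥0) → (Fin d → ℝ≥0) → ℝ) (h₁ h₂ : BoxIndex d → ℝ)
    (u v : Fin d → ℝ≥0) : ℝ :=
  σ * h₁ (u, v) / ((∏ k ∈ firstCoords d s, ((u k : ℝ) + (v k : ℝ))) * D u v)
    + σ * h₂ (u, v) / ((∏ k ∈ firstCoords d s, ((u k : ℝ) + (v k : ℝ))) * D u v)
    + ∑ k ∈ firstCoords d s,
        a k * (((v k : ℝ) ^ (β k + 1) - (-(u k : ℝ)) ^ (β k + 1)) / ((u k : ℝ) + (v k : ℝ)))

/-- `sup_{u ⪰ 0} inf_{v ⪰ 0} F(u, v)` in the extended reals, over the pairs with `u_k + v_k > 0`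
for all `k`; on these pairs, and only on these, no denominator of the fields above vanishes. -/
def supInf {d : ℕ} (F : (Fin d → ℝ≥0) → (Fin d → ℝ≥0) → ℝ) : EReal :=
  ⨆ u : Fin d → ℝ≥0, ⨅ v : Fin d → ℝ≥0, ⨅ _ : ∀ k, 0 < u k + v k, (F u v : EReal)

/-- `inf_{v ⪰ 0} sup_{u ⪰ 0} F(u, v)`, over the same pairs. -/
def infSup {d : ℕ} (F : (Fin d → ℝ≥0) → (Fin d → ℝ≥0) → ℝ) : EReal :=
  ⨅ v : Fin d → ℝ≥0, ⨆ u : Fin d → ℝ≥0, ⨆ _ : ∀ k, 0 < u k + v k, (F u v : EReal)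

/-- The drift coefficients `∂ₖ^{β_k} f (x) / (β_k + 1)!`. -/
def driftCoeff {d : ℕ} (f : (Fin d → ℝ) → ℝ) (x : Fin d → ℝ) (β : Fin d → ℕ) (k : Fin d) : ℝ :=
  partialDerivAt f x k (β k) / ((β k + 1).factorial : ℝ)

/-- `(c · ∏_{k ≤ s} a_k^{1/β_k})^{1/(2 + ∑_{k ≤ s} β_k^{-1})}`.  The two multiplicative constants
are obtained with `a_k = ∂ₖ^{β_k} f (x) / (β_k + 1)!` and `c = σ²`, resp. `c = σ² / g x`. -/
def scaleConst {d : ℕ} (s : ℕ) (β : Fin d → ℕ) (c : ℝ) (a : Fin d → ℝ) : ℝ :=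
  (c * ∏ k ∈ firstCoords d s, (a k) ^ (1 / (β k : ℝ))) ^
    (1 / (2 + ∑ k ∈ firstCoords d s, (β k : ℝ)⁻¹))

end

/-!
The two sides are related by the self-similarity of the processes.  Let `c_k > 0` for `k ≤ s` and
`c_k = 1` for `k > s`.  The rescaling `(u, v) ↦ (c u, c v)` permutes the pairs over which the
extrema are taken, leaves `D_s` unchanged and multiplies the covariance kernel by `m = ∏ c_k`, so
`H_i (c u, c v)` has the law of `√m H_i (u, v)`.  Hence the rescaled noise has the coefficient
`σ₀ / √m` and the `k`-th drift term the coefficient `a_k c_k ^ β_k` (`driftedField_scale`).  The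
choice `c_k = (A / a_k) ^ (1 / β_k)`, with `A` the constant `scaleConst`, makes all of these equal
to `A` (`exists_scale_factors`).  For `s = d`, `D_d` is the constant `g x₀` and the same argument
applies with `m = g x₀ ∏ c_k`.  The coefficients `a_k` are positive because the first non-zero
derivative of a nondecreasing function is (`partialDerivAt_pos`).

What remains is to transfer the law of the processes to the extrema, which run over uncountable
index sets.  The infimum over `v` of a continuous field is merely upper semicontinuous in `u`, so
its supremum cannot be restricted to a dense set of `u` directly.  The set of the `u` is however a
countable union of compact sets on each of which the admissible `v` form a fixed set, and on a
compact set `sup inf` is the infimum over finite sets `F` of `sup min_F`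
(`biSup_biInf_eq_iInf_finset`), which allows dense sets in both variables.  On continuous
paths, the functionals are thus measurable functions of the values at countably many pairs
(`exists_measurable_supInf`; here the continuity and positivity of `D_s` enter), and the law of a
Gaussian process on a countable index set is determined by its mean and covariance.
-/

/-! ### Suprema and infima over compact pieces -/

/-- For a separately continuous `f` and a compact `K`, `sup_K inf_V f` only involves the values
of `f` on a product of dense subsets: the superlevel sets `{u ∈ K | t ≤ f u v}` are compact, so
their intersection over all `v` is nonempty as soon as all finite ones are, and a supremum of a
minimum of finitely many continuous functions is determined on a dense subset. -/
theorem biSup_biInf_eq_iInf_finset {X Y : Type*} [TopologicalSpace X] [TopologicalSpace Y]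
    {K S : Set X} {V T : Set Y} (hK : IsCompact K) (hSK : S ⊆ K) (hKS : K ⊆ closure S)
    (hTV : T ⊆ V) (hVT : V ⊆ closure T) {f : X → Y → ℝ}
    (hfu : ∀ u ∈ K, ContinuousOn (f u) V) (hfv : ∀ v ∈ V, ContinuousOn (fun u => f u v) K) :
    ⨆ u ∈ K, ⨅ v ∈ V, (f u v : EReal) =
      ⨅ F : Finset T, ⨆ u ∈ S, ⨅ v ∈ F, (f u v : EReal) := by
  apply le_antisymm
  · refine le_iInf fun F => iSup₂_le fun u hu => le_of_forall_lt_imp_le_of_dense fun t ht => ?_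
    have hev : ∀ᶠ u' in 𝓝[K] u, ∀ v ∈ F, t < (f u' v : EReal) := by
      rw [Filter.eventually_all_finset]
      intro v _
      have hc : Tendsto (fun u' => (f u' v : EReal)) (𝓝[K] u) (𝓝 (f u v : EReal)) :=
        (continuous_coe_real_ereal.tendsto _).comp (hfv v (hTV v.2) u hu)
      exact hc.eventually (lt_mem_nhds (ht.trans_le (iInf₂_le (v : Y) (hTV v.2))))
    have : (𝓝[S] u).NeBot := mem_closure_iff_nhdsWithin_neBot.1 (hKS hu)
    obtain ⟨u', hu', hu'S⟩ :=
      ((hev.filter_mono (nhdsWithin_mono u hSK)).and self_mem_nhdsWithin).exists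
    exact le_iSup₂_of_le u' hu'S (le_iInf₂ fun v hv => (hu' v hv).le)
  · refine le_of_forall_lt_imp_le_of_dense fun t ht => ?_
    have : CompactSpace K := isCompact_iff_compactSpace.1 hK
    obtain ⟨u, hu⟩ : (⋂ v : T, {u : K | t ≤ (f u v : EReal)}).Nonempty := by
      refine CompactSpace.iInter_nonempty (fun v => ?_) fun F => ?_
      · have hc := continuousOn_iff_continuous_domRestrict.1 (hfv v (hTV v.2))
        exact isClosed_le continuous_const (continuous_coe_real_ereal.comp hc)
      · obtain ⟨u, hu⟩ := lt_iSup_iff.1 (ht.trans_le (iInf_le _ F))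
        obtain ⟨huS, hu⟩ := lt_iSup_iff.1 hu
        refine ⟨⟨u, hSK huS⟩, mem_iInter₂.2 fun v hv => ?_⟩
        exact hu.le.trans (iInf₂_le v hv)
    refine le_iSup₂_of_le (u : X) u.2 (le_iInf₂ fun v hv => ?_)
    have : (𝓝[T] v).NeBot := mem_closure_iff_nhdsWithin_neBot.1 (hVT hv)
    have hc : Tendsto (fun v' => (f u v' : EReal)) (𝓝[T] v) (𝓝 (f u v : EReal)) :=
      (continuous_coe_real_ereal.tendsto _).comp
        ((hfu u u.2 v hv).mono_left (nhdsWithin_mono v hTV))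
    refine ge_of_tendsto hc (eventually_nhdsWithin_of_forall fun v' hv' => ?_)
    exact mem_iInter.1 hu ⟨v', hv'⟩

/-- The pairs `(u, v)` over which `supInf` and `infSup` are taken. -/
def admissiblePairs (d : ℕ) : Set (BoxIndex d) :=
  {p | ∀ k, 0 < p.1 k + p.2 k}

/-- The compact set of the `u` that vanish exactly on `i.1`, and whose other coordinates are
between `1 / (i.2 + 1)` and `i.2 + 1`. -/
def compactPiece {d : ℕ} (i : Finset (Fin d) × ℕ) : Set (Fin d → ℝ≥0) :=
  Set.pi univ fun k => if k ∈ i.1 then {0} else Icc (1 / ((i.2 : ℝ≥0) + 1)) ((i.2 : ℝ≥0) + 1)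

/-- The `v` that are admissible together with all `u` vanishing exactly on `Z`. -/
def positiveOn {d : ℕ} (Z : Finset (Fin d)) : Set (Fin d → ℝ≥0) :=
  {v | ∀ k ∈ Z, 0 < v k}

lemma isCompact_compactPiece {d : ℕ} (i : Finset (Fin d) × ℕ) : IsCompact (compactPiece i) := by
  refine isCompact_univ_pi fun k => ?_
  split_ifs
  exacts [isCompact_singleton, isCompact_Icc]

lemma forall_add_pos_iff_mem_positiveOn {d : ℕ} {i : Finset (Fin d) × ℕ} {u : Fin d → ℝ≥0}
    (hu : u ∈ compactPiece i) (v : Fin d → ℝ≥0) :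
    (∀ k, 0 < u k + v k) ↔ v ∈ positiveOn i.1 := by
  have h (k : Fin d) := hu k (mem_univ k)
  refine ⟨fun hv k hk => ?_, fun hv k => ?_⟩
  · have := h k
    simp only [if_pos hk] at this
    simpa [mem_singleton_iff.1 this] using hv k
  · by_cases hk : k ∈ i.1
    · exact (hv k hk).trans_le le_add_self
    · have := h k
      simp only [if_neg hk] at this
      exact (lt_of_lt_of_le (by positivity) this.1).trans_le le_self_add

lemma exists_mem_compactPiece {d : ℕ} (u : Fin d → ℝ≥0) : ∃ i, u ∈ compactPiece i := by
  obtain ⟨n, hn⟩ := exists_nat_ge (∑ k, (u k + (u k)⁻¹))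
  have hle (k : Fin d) : u k + (u k)⁻¹ ≤ n + 1 :=
    ((Finset.single_le_sum (f := fun k => u k + (u k)⁻¹) (fun _ _ => zero_le)
      (Finset.mem_univ k)).trans hn).trans le_self_add
  refine ⟨(Finset.univ.filter fun k => u k = 0, n), fun k _ => ?_⟩
  by_cases hk : u k = 0
  · simp [hk]
  · simp only [Finset.mem_filter, Finset.mem_univ, true_and, hk, if_false]
    refine ⟨?_, le_self_add.trans (hle k)⟩
    rw [one_div]
    exact inv_le_of_inv_le₀ (pos_iff_ne_zero.2 hk) (le_add_self.trans (hle k))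

lemma supInf_eq_iSup_compactPiece {d : ℕ} (F : (Fin d → ℝ≥0) → (Fin d → ℝ≥0) → ℝ) :
    supInf F = ⨆ i, ⨆ u ∈ compactPiece i, ⨅ v ∈ positiveOn i.1, (F u v : EReal) := by
  have key {i : Finset (Fin d) × ℕ} {u : Fin d → ℝ≥0} (hu : u ∈ compactPiece i) :
      ⨅ v, ⨅ _ : ∀ k, 0 < u k + v k, (F u v : EReal) =
        ⨅ v ∈ positiveOn i.1, (F u v : EReal) := by
    simp_rw [forall_add_pos_iff_mem_positiveOn hu]
  apply le_antisymm
  · refine iSup_le fun u => ?_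
    obtain ⟨i, hi⟩ := exists_mem_compactPiece u
    exact (key hi).le.trans (le_iSup_of_le i (le_iSup₂_of_le u hi le_rfl))
  · exact iSup_le fun i => iSup₂_le fun u hu =>
      (key hu).ge.trans (le_iSup (fun u => ⨅ v, ⨅ _ : ∀ k, 0 < u k + v k, (F u v : EReal)) u)

/-- On the fields that are continuous on the admissible pairs, `supInf` is a measurable functional
of the values at countably many pairs. -/
theorem exists_measurable_supInf {d : ℕ} {Θ : BoxIndex d → ℝ → ℝ}
    (hΘ : ∀ p, Measurable (Θ p)) :
    ∃ C : Set (BoxIndex d), C.Countable ∧ ∃ Φ : (C → ℝ) → EReal, Measurable Φ ∧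
      ∀ h : BoxIndex d → ℝ, ContinuousOn (fun p => Θ p (h p)) (admissiblePairs d) →
        supInf (fun u v => Θ (u, v) (h (u, v))) = Φ (C.domRestrict h) := by
  classical
  have hS (i : Finset (Fin d) × ℕ) :=
    (TopologicalSpace.IsSeparable.of_separableSpace
      (compactPiece i)).exists_countable_dense_subset
  have hT (i : Finset (Fin d) × ℕ) :=
    (TopologicalSpace.IsSeparable.of_separableSpace
      (positiveOn i.1)).exists_countable_dense_subset
  choose S hSK hSc hKS using hS
  choose T hTV hTc hVT using hT
  set C : Set (BoxIndex d) := ⋃ i, S i ×ˢ T i with hC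
  have (i : Finset (Fin d) × ℕ) : Countable (T i) := (hTc i).to_subtype
  refine ⟨C, countable_iUnion fun i => (hSc i).prod (hTc i),
    fun h => ⨆ i, ⨅ F : Finset (T i), ⨆ u ∈ S i, ⨅ v ∈ F,
      (Θ (u, v) (if hp : (u, (v : Fin d → ℝ≥0)) ∈ C then h ⟨_, hp⟩ else 0) : EReal), ?_, ?_⟩
  · refine .iSup fun i => .iInf fun F => .biSup _ (hSc i) fun u _ =>
      .biInf _ F.countable_toSet fun v _ => ?_
    refine measurable_coe_real_ereal.comp ((hΘ _).comp ?_)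
    split_ifs
    exacts [measurable_pi_apply _, measurable_const]
  · intro h hc
    rw [supInf_eq_iSup_compactPiece]
    refine iSup_congr fun i => ?_
    have hadm {u v : Fin d → ℝ≥0} (hu : u ∈ compactPiece i) (hv : v ∈ positiveOn i.1) :
        (u, v) ∈ admissiblePairs d := (forall_add_pos_iff_mem_positiveOn hu v).2 hv
    rw [biSup_biInf_eq_iInf_finset (f := fun u v => Θ (u, v) (h (u, v)))
      (isCompact_compactPiece i) (hSK i) (hKS i) (hTV i) (hVT i)
      (fun u hu => hc.comp (by fun_prop) fun v hv => hadm hu hv)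
      (fun v hv => hc.comp (f := fun u => (u, v)) (by fun_prop) fun u hu => hadm hu hv)]
    refine iInf_congr fun F => iSup_congr fun u => iSup_congr fun hu => iInf_congr fun v =>
      iInf_congr fun _ => ?_
    have hmem : (u, (v : Fin d → ℝ≥0)) ∈ C := mem_iUnion.2 ⟨i, hu, v.2⟩
    rw [dif_pos hmem]
    rfl

/-! ### The functionals in the extended reals -/

lemma EReal.neg_iSup {ι : Sort*} (f : ι → EReal) : -(⨆ i, f i) = ⨅ i, -f i :=
  EReal.negOrderIso.map_iSup f

lemma EReal.neg_iInf {ι : Sort*} (f : ι → EReal) : -(⨅ i, f i) = ⨆ i, -f i :=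
  EReal.negOrderIso.map_iInf f

lemma infSup_eq_neg_supInf {d : ℕ} (F : (Fin d → ℝ≥0) → (Fin d → ℝ≥0) → ℝ) :
    infSup F = -supInf (fun v u => -F u v) := by
  simp only [infSup, supInf, EReal.neg_iSup, EReal.neg_iInf, EReal.coe_neg, neg_neg, add_comm]

/-- Multiplication by a positive real, as an order isomorphism of the extended reals. -/
noncomputable def EReal.mulOrderIso (c : ℝ) (hc : 0 < c) : EReal ≃o EReal where
  toFun x := c * x
  invFun x := (c⁻¹ : ℝ) * x
  left_inv x := by
    beta_reduce
    rw [← mul_assoc, ← EReal.coe_mul, inv_mul_cancel₀ hc.ne']; simp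
  right_inv x := by
    beta_reduce
    rw [← mul_assoc, ← EReal.coe_mul, mul_inv_cancel₀ hc.ne']; simp
  map_rel_iff' {x y} := by
    refine ⟨fun h => ?_, fun h => mul_le_mul_of_nonneg_left h (by exact_mod_cast hc.le)⟩
    have := mul_le_mul_of_nonneg_left h
      (show (0 : EReal) ≤ (c⁻¹ : ℝ) by exact_mod_cast (inv_pos.2 hc).le)
    simpa [← mul_assoc, ← EReal.coe_mul, inv_mul_cancel₀ hc.ne'] using this

lemma mul_supInf {d : ℕ} {c : ℝ} (hc : 0 < c) (F : (Fin d → ℝ≥0) → (Fin d → ℝ≥0) → ℝ) :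
    (c : EReal) * supInf F = supInf fun u v => c * F u v := by
  change EReal.mulOrderIso c hc (supInf F) = _
  simp only [supInf, OrderIso.map_iSup, OrderIso.map_iInf, EReal.coe_mul]
  rfl

lemma mul_infSup {d : ℕ} {c : ℝ} (hc : 0 < c) (F : (Fin d → ℝ≥0) → (Fin d → ℝ≥0) → ℝ) :
    (c : EReal) * infSup F = infSup fun u v => c * F u v := by
  change EReal.mulOrderIso c hc (infSup F) = _
  simp only [infSup, OrderIso.map_iSup, OrderIso.map_iInf, EReal.coe_mul]
  rfl

lemma scale_surjective {d : ℕ} {c : Fin d → ℝ≥0} (hc : ∀ k, 0 < c k) :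
    Function.Surjective fun u : Fin d → ℝ≥0 => c * u := fun u =>
  ⟨fun k => (c k)⁻¹ * u k, funext fun k => mul_inv_cancel_left₀ (hc k).ne' _⟩

lemma forall_scale_add_pos_iff {d : ℕ} {c : Fin d → ℝ≥0} (hc : ∀ k, 0 < c k)
    (u v : Fin d → ℝ≥0) : (∀ k, 0 < (c * u) k + (c * v) k) ↔ ∀ k, 0 < u k + v k :=
  forall_congr' fun k => by
    rw [Pi.mul_apply, Pi.mul_apply, ← mul_add, mul_pos_iff_of_pos_left (hc k)]

/-- `supInf` is invariant under a coordinatewise rescaling of both variables. -/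
lemma supInf_scale {d : ℕ} {c : Fin d → ℝ≥0} (hc : ∀ k, 0 < c k)
    (F : (Fin d → ℝ≥0) → (Fin d → ℝ≥0) → ℝ) :
    supInf F = supInf fun u v => F (c * u) (c * v) := by
  unfold supInf
  rw [← (scale_surjective hc).iSup_comp]
  refine iSup_congr fun u => ?_
  rw [← (scale_surjective hc).iInf_comp]
  simp_rw [forall_scale_add_pos_iff hc]

/-- `infSup` is invariant under a coordinatewise rescaling of both variables. -/
lemma infSup_scale {d : ℕ} {c : Fin d → ℝ≥0} (hc : ∀ k, 0 < c k)
    (F : (Fin d → ℝ≥0) → (Fin d → ℝ≥0) → ℝ) :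
    infSup F = infSup fun u v => F (c * u) (c * v) := by
  simp only [infSup_eq_neg_supInf]
  rw [supInf_scale hc]

/-! ### The law of a Gaussian process on a countable index set -/

/-- On a countable index set, two Gaussian processes, possibly on different probability spaces,
with the same means and covariances have the same law. -/
theorem map_eq_of_isGaussianProcess {ι Ω Ω' : Type*} [Countable ι] [MeasurableSpace Ω]
    [MeasurableSpace Ω'] {μ : Measure Ω} {ν : Measure Ω'} {X : ι → Ω → ℝ} {Y : ι → Ω' → ℝ}
    (hX : IsGaussianProcess X μ) (hY : IsGaussianProcess Y ν)
    (hmean : ∀ i, ∫ ω, X i ω ∂μ = ∫ ω, Y i ω ∂ν)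
    (hcov : ∀ i j, covariance (X i) (X j) μ = covariance (Y i) (Y j) ν) :
    μ.map (fun ω i => X i ω) = ν.map (fun ω i => Y i ω) := by
  have := hX.isProbabilityMeasure
  have := hY.isProbabilityMeasure
  have hfin (I : Finset ι) : μ.map (fun ω => I.restrict (X · ω)) =
      ν.map (fun ω => I.restrict (Y · ω)) := by
    classical
    have hL (L : StrongDual ℝ (I → ℝ)) (x : ι → ℝ) :
        L (I.restrict x) = ∑ i : I, L (Pi.single i 1) * x i := by
      conv_lhs => rw [pi_eq_sum_univ' (I.restrict x)]
      simp [mul_comm]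
    refine Measure.ext_of_charFunDual (funext fun L => ?_)
    rw [(hX.hasGaussianLaw I).charFunDual_map_eq_fun, (hY.hasGaussianLaw I).charFunDual_map_eq_fun]
    simp_rw [hL]
    have hX2 (i : I) : MemLp (fun ω => L (Pi.single i 1) * X i ω) 2 μ :=
      (hX.hasGaussianLaw_eval i).memLp_two.const_mul _
    have hY2 (i : I) : MemLp (fun ω => L (Pi.single i 1) * Y i ω) 2 ν :=
      (hY.hasGaussianLaw_eval i).memLp_two.const_mul _
    rw [integral_finsetSum _ fun i _ => (hX2 i).integrable one_le_two,
      integral_finsetSum _ fun i _ => (hY2 i).integrable one_le_two,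
      variance_fun_sum hX2, variance_fun_sum hY2]
    simp_rw [covariance_const_mul_left, covariance_const_mul_right, integral_const_mul, hmean,
      hcov]
  have hXm : AEMeasurable (fun ω i => X i ω) μ := aemeasurable_pi_lambda _ hX.aemeasurable
  have hYm : AEMeasurable (fun ω i => Y i ω) ν := aemeasurable_pi_lambda _ hY.aemeasurable
  have hlim := isProjectiveLimit_map hXm
  simp_rw [hfin] at hlim
  exact hlim.unique (isProjectiveLimit_map hYm)

/-- The law of the sum of two independent processes on a countable index set is determined by the
laws of the summands. -/
theorem map_add_eq_of_indepFun {ι Ω Ω' : Type*} [Countable ι] [MeasurableSpace Ω]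
    [MeasurableSpace Ω'] {μ : Measure Ω} {ν : Measure Ω'} [IsFiniteMeasure μ] [IsFiniteMeasure ν]
    {X₁ X₂ : Ω → ι → ℝ} {Y₁ Y₂ : Ω' → ι → ℝ}
    (hX₁ : AEMeasurable X₁ μ) (hX₂ : AEMeasurable X₂ μ)
    (hY₁ : AEMeasurable Y₁ ν) (hY₂ : AEMeasurable Y₂ ν)
    (hX : IndepFun X₁ X₂ μ) (hY : IndepFun Y₁ Y₂ ν)
    (h₁ : μ.map X₁ = ν.map Y₁) (h₂ : μ.map X₂ = ν.map Y₂) :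
    IdentDistrib (fun ω => X₁ ω + X₂ ω) (fun ω => Y₁ ω + Y₂ ω) μ ν := by
  have hpair : IdentDistrib (fun ω => (X₁ ω, X₂ ω)) (fun ω => (Y₁ ω, Y₂ ω)) μ ν := by
    refine ⟨hX₁.prodMk hX₂, hY₁.prodMk hY₂, ?_⟩
    rw [(indepFun_iff_map_prod_eq_prod_map_map hX₁ hX₂).1 hX,
      (indepFun_iff_map_prod_eq_prod_map_map hY₁ hY₂).1 hY, h₁, h₂]
  exact hpair.comp (u := fun p : (ι → ℝ) × (ι → ℝ) => p.1 + p.2) (by fun_prop)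

/-! ### The mass of a slice -/

/-- The region of integration in `sliceMass`. -/
def sliceBox {d : ℕ} (x₀ : Fin d → ℝ) (s : ℕ) (p : BoxIndex d) :
    Set ({k : Fin d // s ≤ (k : ℕ)} → ℝ) :=
  {y | ∀ k, y k ∈ Icc (x₀ k.1 - p.1 k.1) (x₀ k.1 + p.2 k.1) ∩ Icc (0 : ℝ) 1}

/-- The density on the slice through `x₀` in which the first `s` coordinates are fixed. -/
def sliceDensity {d : ℕ} (g : (Fin d → ℝ) → ℝ) (x₀ : Fin d → ℝ) (s : ℕ)
    (y : {k : Fin d // s ≤ (k : ℕ)} → ℝ) : ℝ :=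
  g (fun k => if h : s ≤ (k : ℕ) then y ⟨k, h⟩ else x₀ k)

section Slice

variable {d s : ℕ} {g : (Fin d → ℝ) → ℝ} {x₀ : Fin d → ℝ}

lemma sliceBox_subset (p : BoxIndex d) : sliceBox x₀ s p ⊆ Icc 0 1 :=
  fun _ hy => ⟨fun k => (hy k).2.1, fun k => (hy k).2.2⟩

lemma measurableSet_sliceBox (p : BoxIndex d) : MeasurableSet (sliceBox x₀ s p) := by
  have : sliceBox x₀ s p = Set.pi univ fun k : {k : Fin d // s ≤ (k : ℕ)} =>
      Icc (x₀ k.1 - p.1 k.1) (x₀ k.1 + p.2 k.1) ∩ Icc (0 : ℝ) 1 := by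
    ext y; simp [sliceBox]
  rw [this]
  exact .univ_pi fun k => measurableSet_Icc.inter measurableSet_Icc

lemma continuousOn_sliceDensity (hx₀ : ∀ k, x₀ k ∈ Ioo (0 : ℝ) 1)
    (hg : IsPredictorDensity g x₀ s) : ContinuousOn (sliceDensity g x₀ s) (Icc 0 1) := by
  obtain ⟨V, -, hV, hgV⟩ := hg.continuous
  refine hgV.comp (f := fun (y : {k : Fin d // s ≤ (k : ℕ)} → ℝ) (k : Fin d) =>
    if h : s ≤ (k : ℕ) then y ⟨k, h⟩ else x₀ k) ?_ fun y hy => ⟨hV ⟨?_, ?_⟩, ?_, ?_⟩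
  · refine (continuous_pi fun k => ?_).continuousOn
    split_ifs <;> fun_prop
  · exact fun k hk => dif_neg (not_le.2 hk)
  · intro k hk
    simp only [hk, dif_pos]
    exact ⟨hy.1 _, hy.2 _⟩
  · intro k
    dsimp only
    split_ifs
    exacts [hy.1 _, (hx₀ k).1.le]
  · intro k
    dsimp only
    split_ifs
    exacts [hy.2 _, (hx₀ k).2.le]

lemma exists_bounds_sliceDensity (hx₀ : ∀ k, x₀ k ∈ Ioo (0 : ℝ) 1)
    (hg : IsPredictorDensity g x₀ s) : ∃ a₁ a₂ : ℝ, 0 < a₁ ∧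
      ∀ y ∈ Icc (0 : {k : Fin d // s ≤ (k : ℕ)} → ℝ) 1,
        a₁ ≤ sliceDensity g x₀ s y ∧ sliceDensity g x₀ s y ≤ a₂ := by
  obtain ⟨a₁, a₂, ha₁, h⟩ := hg.bounded
  refine ⟨a₁, a₂, ha₁, fun y hy => h _ ⟨fun k => ?_, fun k => ?_⟩⟩ <;> dsimp only <;> split_ifs
  exacts [hy.1 _, (hx₀ k).1.le, hy.2 _, (hx₀ k).2.le]

lemma sliceMass_eq_integral_indicator (p : BoxIndex d) :
    sliceMass g x₀ s p.1 p.2 =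
      ∫ y in Icc 0 1, (sliceBox x₀ s p).indicator (sliceDensity g x₀ s) y := by
  rw [setIntegral_indicator (measurableSet_sliceBox p),
    inter_eq_self_of_subset_right (sliceBox_subset p)]
  rfl

/-- Dominated convergence: unless a coordinate of `y` is an endpoint of the corresponding
interval, `y` stays inside or outside of `sliceBox x₀ s p` under small changes of `p`. -/
lemma continuous_sliceMass (hx₀ : ∀ k, x₀ k ∈ Ioo (0 : ℝ) 1) (hg : IsPredictorDensity g x₀ s) :
    Continuous fun p : BoxIndex d => sliceMass g x₀ s p.1 p.2 := by
  obtain ⟨a₁, a₂, ha₁, hb⟩ := exists_bounds_sliceDensity hx₀ hg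
  simp_rw [sliceMass_eq_integral_indicator]
  refine continuous_iff_continuousAt.2 fun p => ?_
  refine continuousAt_of_dominated (bound := fun _ => a₂) (.of_forall fun q => ?_)
    (.of_forall fun q => ?_) ?_ ?_
  · exact ((continuousOn_sliceDensity hx₀ hg).aestronglyMeasurable measurableSet_Icc).indicator
      (measurableSet_sliceBox q)
  · refine (ae_restrict_iff' measurableSet_Icc).2 (.of_forall fun y hy => ?_)
    have := hb y hy
    by_cases hq : y ∈ sliceBox x₀ s q
    · rw [indicator_of_mem hq, Real.norm_eq_abs, abs_of_nonneg (ha₁.le.trans this.1)]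
      exact this.2
    · rw [indicator_of_notMem hq, norm_zero]
      exact ha₁.le.trans (this.1.trans this.2)
  · exact integrableOn_const isCompact_Icc.measure_lt_top.ne
  · have hne : ∀ᵐ y : {k : Fin d // s ≤ (k : ℕ)} → ℝ, ∀ k,
        y k ≠ x₀ k.1 - p.1 k.1 ∧ y k ≠ x₀ k.1 + p.2 k.1 :=
      ae_all_iff.2 fun k => (Measure.ae_eval_ne _ k _).and (Measure.ae_eval_ne _ k _)
    filter_upwards [ae_restrict_of_ae hne] with y hy
    have hl (k : Fin d) : Continuous fun q : BoxIndex d => x₀ k - q.1 k := by fun_prop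
    have hr (k : Fin d) : Continuous fun q : BoxIndex d => x₀ k + q.2 k := by fun_prop
    by_cases hp : y ∈ sliceBox x₀ s p
    · have : ∀ᶠ q in 𝓝 p, y ∈ sliceBox x₀ s q := by
        refine eventually_all.2 fun k => ?_
        filter_upwards [(hl k).continuousAt.eventually
            (gt_mem_nhds ((hp k).1.1.lt_of_ne (hy k).1.symm)),
          (hr k).continuousAt.eventually
            (lt_mem_nhds ((hp k).1.2.lt_of_ne (hy k).2))] with q h₁ h₂
        exact ⟨⟨h₁.le, h₂.le⟩, (hp k).2⟩
      exact continuousAt_const.congr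
        (this.mono fun q hq => (indicator_of_mem hq (sliceDensity g x₀ s)).symm)
    · obtain ⟨k, hk⟩ : ∃ k : {k : Fin d // s ≤ (k : ℕ)},
          y k ∉ Icc (x₀ k.1 - p.1 k.1) (x₀ k.1 + p.2 k.1) ∩ Icc (0 : ℝ) 1 :=
        not_forall.1 hp
      have : ∀ᶠ q in 𝓝 p, y ∉ sliceBox x₀ s q := by
        by_cases h01 : y k ∈ Icc (0 : ℝ) 1
        · by_cases hlt : y k < x₀ k.1 - p.1 k.1
          · filter_upwards [(hl k).continuousAt.eventually (lt_mem_nhds hlt)] with q hq hmem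
            exact absurd (hmem k).1.1 (not_le.2 hq)
          · have hgt : x₀ k.1 + p.2 k.1 < y k :=
              not_le.1 fun h => hk ⟨⟨not_lt.1 hlt, h⟩, h01⟩
            filter_upwards [(hr k).continuousAt.eventually (gt_mem_nhds hgt)] with q hq hmem
            exact absurd (hmem k).1.2 (not_le.2 hq)
        · exact .of_forall fun q hmem => h01 (hmem k).2
      exact continuousAt_const.congr
        (this.mono fun q hq => (indicator_of_notMem hq (sliceDensity g x₀ s)).symm)

lemma sliceMass_pos (hx₀ : ∀ k, x₀ k ∈ Ioo (0 : ℝ) 1) (hg : IsPredictorDensity g x₀ s)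
    {p : BoxIndex d} (hp : p ∈ admissiblePairs d) : 0 < sliceMass g x₀ s p.1 p.2 := by
  obtain ⟨a₁, a₂, ha₁, hb⟩ := exists_bounds_sliceDensity hx₀ hg
  have hfin : volume (sliceBox x₀ s p) ≠ ⊤ :=
    ((measure_mono (sliceBox_subset p)).trans_lt isCompact_Icc.measure_lt_top).ne
  have hpos : 0 < volume.real (sliceBox x₀ s p) := by
    refine ENNReal.toReal_pos (ne_of_gt ?_) hfin
    let U : Set ({k : Fin d // s ≤ (k : ℕ)} → ℝ) := Set.pi univ fun k =>
      Ioo (max (x₀ k.1 - p.1 k.1) 0) (min (x₀ k.1 + p.2 k.1) 1)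
    have hU : IsOpen U := isOpen_set_pi finite_univ fun k _ => isOpen_Ioo
    have hne : U.Nonempty := univ_pi_nonempty_iff.2 fun k => by
      have h := hx₀ k.1
      have hk : (0 : ℝ) < p.1 k.1 + p.2 k.1 := by exact_mod_cast hp k.1
      have h₁ : (0 : ℝ) ≤ p.1 k.1 := NNReal.coe_nonneg _
      have h₂ : (0 : ℝ) ≤ p.2 k.1 := NNReal.coe_nonneg _
      refine nonempty_Ioo.2 (max_lt (lt_min ?_ ?_) (lt_min ?_ ?_)) <;> linarith [h.1, h.2]
    refine (hU.measure_pos volume hne).trans_le (measure_mono fun y hy k => ?_)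
    have h := hy k (mem_univ k)
    exact ⟨⟨(le_max_left _ _).trans h.1.le, h.2.le.trans (min_le_left _ _)⟩,
      (le_max_right _ _).trans h.1.le, h.2.le.trans (min_le_right _ _)⟩
  have hint : IntegrableOn (sliceDensity g x₀ s) (sliceBox x₀ s p) :=
    ((continuousOn_sliceDensity hx₀ hg).integrableOn_compact isCompact_Icc).mono_set
      (sliceBox_subset p)
  exact (mul_pos ha₁ hpos).trans_le (setIntegral_ge_of_const_le_real (measurableSet_sliceBox p)
    hfin (fun y hy => (hb y (sliceBox_subset p hy)).1) hint)

/-- `sliceMass` only depends on the coordinates that are integrated. -/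
lemma sliceMass_congr {u v u' v' : Fin d → ℝ≥0} (hu : ∀ k : Fin d, s ≤ (k : ℕ) → u k = u' k)
    (hv : ∀ k : Fin d, s ≤ (k : ℕ) → v k = v' k) :
    sliceMass g x₀ s u v = sliceMass g x₀ s u' v' := by
  unfold sliceMass
  congr 2
  ext y
  exact forall_congr' fun k => by rw [hu k.1 k.2, hv k.1 k.2]

lemma sliceMass_self (u v : Fin d → ℝ≥0) : sliceMass g x₀ d u v = g x₀ := by
  have : IsEmpty {k : Fin d // d ≤ (k : ℕ)} := ⟨fun k => absurd k.2 (not_le.2 k.1.2)⟩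
  have h (k : Fin d) : ¬ d ≤ (k : ℕ) := not_le.2 k.2
  simp [sliceMass, h, measureReal_def, volume_pi]

end Slice

/-! ### The first non-zero derivative of a nondecreasing function -/

/-- If the first non-zero derivative of `φ` at `x` is negative, then `φ` takes values smaller than
`φ x` just to the right of `x`.  The same holds for all lower derivatives, by descending
induction on the order: a derivative that is negative just to the right of `x` makes the
derivative one order below strictly decreasing there. -/
theorem eventually_iteratedDeriv_lt {φ : ℝ → ℝ} {x : ℝ} {n : ℕ}
    (hd : ∀ m < n, DifferentiableAt ℝ (iteratedDeriv m φ) x ∧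
      (m + 1 < n → ∀ᶠ t in 𝓝 x, DifferentiableAt ℝ (iteratedDeriv m φ) t))
    (hz : ∀ m, 1 ≤ m → m < n → iteratedDeriv m φ x = 0) (hn : iteratedDeriv n φ x < 0)
    {m : ℕ} (hm : m < n) :
    ∀ᶠ t in 𝓝[>] x, iteratedDeriv m φ t < iteratedDeriv m φ x := by
  obtain ⟨N, rfl⟩ : ∃ N, n = N + 1 := ⟨n - 1, by omega⟩
  refine Nat.decreasingInduction
    (motive := fun m _ => ∀ᶠ t in 𝓝[>] x, iteratedDeriv m φ t < iteratedDeriv m φ x)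
    (fun m hm ih => ?_) ?_ (Nat.lt_succ_iff.1 hm)
  · have hdiff := (hd m (by omega)).2 (by omega)
    rw [hz (m + 1) (by omega) (by omega)] at ih
    obtain ⟨ε, hε, hball⟩ := Metric.eventually_nhds_iff.1 hdiff
    obtain ⟨b, hb, hneg⟩ := mem_nhdsGT_iff_exists_Ioo_subset.1 ih
    have hxb : x < min b (x + ε) := lt_min hb (by linarith)
    filter_upwards [Ioo_mem_nhdsGT hxb] with t ht
    have hanti : StrictAntiOn (iteratedDeriv m φ) (Icc x t) := by
      refine strictAntiOn_of_deriv_neg (convex_Icc x t) (fun r hr => ?_) fun r hr => ?_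
      · refine (hball ?_).continuousAt.continuousWithinAt
        rw [Real.dist_eq, abs_of_nonneg (by linarith [hr.1])]
        linarith [hr.2, ht.2, min_le_right b (x + ε)]
      · rw [interior_Icc] at hr
        rw [← iteratedDeriv_succ]
        exact hneg ⟨hr.1, hr.2.trans (ht.2.trans_le (min_le_left _ _))⟩
    exact hanti (left_mem_Icc.2 ht.1.le) (right_mem_Icc.2 ht.1.le) ht.1
  · have hder := (hd N (by omega)).1.hasDerivAt
    rw [← iteratedDeriv_succ] at hder
    have hslope := (hasDerivAt_iff_tendsto_slope.1 hder).eventually (gt_mem_nhds hn)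
    filter_upwards [hslope.filter_mono (nhdsWithin_mono x fun t ht => ne_of_gt ht),
      self_mem_nhdsWithin] with t ht hxt
    rw [slope_def_field, div_neg_iff] at ht
    have : x < t := hxt
    rcases ht with h | h <;> linarith [h.1, h.2]

section FirstDerivative

variable {d : ℕ} {f : (Fin d → ℝ) → ℝ} {x : Fin d → ℝ} {k : Fin d} {n : ℕ}

lemma partialDerivAt_eq_zero_of_lt (h : firstDerivOrder f x k = n) {m : ℕ} (hm : 1 ≤ m)
    (hmn : m < n) : partialDerivAt f x k m = 0 := by
  by_contra hne
  have : firstDerivOrder f x k ≤ m := iInf₂_le m ⟨hm, hne⟩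
  rw [h] at this
  exact absurd (by exact_mod_cast this) (not_le.2 hmn)

lemma one_le_and_partialDerivAt_ne_zero (h : firstDerivOrder f x k = n) :
    1 ≤ n ∧ partialDerivAt f x k n ≠ 0 := by
  by_contra hn
  have : ((n + 1 : ℕ) : ℕ∞) ≤ firstDerivOrder f x k := by
    refine le_iInf₂ fun m hm => ?_
    have h₁ : n ≤ m := by
      have : firstDerivOrder f x k ≤ m := iInf₂_le m hm
      rw [h] at this
      exact_mod_cast this
    have h₂ : n ≠ m := fun he => hn (he ▸ hm)
    exact_mod_cast (by omega : n + 1 ≤ m)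
  rw [h] at this
  exact absurd (by exact_mod_cast this : n + 1 ≤ n) (by omega)

/-- The first non-zero derivative of a nondecreasing function along a coordinate is positive. -/
theorem partialDerivAt_pos (hf : MonotoneOn f (Icc 0 1)) (hx : ∀ k, x k ∈ Ioo (0 : ℝ) 1)
    (h : firstDerivOrder f x k = n) (hd : HasPartialDerivAt f x k n) :
    0 < partialDerivAt f x k n := by
  obtain ⟨hn, hne⟩ := one_le_and_partialDerivAt_ne_zero h
  by_contra hle
  have hlt := eventually_iteratedDeriv_lt hd (fun m => partialDerivAt_eq_zero_of_lt h)
    (lt_of_le_of_ne (not_lt.1 hle) hne) hn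
  obtain ⟨t, ht, hxt⟩ := (hlt.and (Ioo_mem_nhdsGT (hx k).2)).exists
  have hmem {r : ℝ} (hr : r ∈ Icc (0 : ℝ) 1) : Function.update x k r ∈ Icc 0 1 := by
    refine ⟨fun j => ?_, fun j => ?_⟩ <;> rcases eq_or_ne j k with rfl | hj <;>
      simp [*, (hx _).1.le, (hx _).2.le, hr.1, hr.2]
  have hmono := hf (hmem ⟨(hx k).1.le, (hx k).2.le⟩)
    (hmem ⟨((hx k).1.trans hxt.1).le, hxt.2.le⟩)
    (update_le_update_iff.2 ⟨hxt.1.le, fun _ _ => le_rfl⟩)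
  simp only [iteratedDeriv_zero] at ht
  exact absurd hmono (not_le.2 ht)

end FirstDerivative

/-! ### Laws of the functionals -/

section Processes

variable {d : ℕ} {Ω Ω' : Type*} [MeasurableSpace Ω] [MeasurableSpace Ω'] {μ : Measure Ω}
  {ν : Measure Ω'} {K : BoxIndex d → BoxIndex d → ℝ}

lemma IsCenteredGaussianWithKernel.const_mul_comp {H : BoxIndex d → Ω → ℝ}
    (hH : IsCenteredGaussianWithKernel H K μ) (c : ℝ) {f : BoxIndex d → BoxIndex d}
    (hf : Continuous f) :
    IsCenteredGaussianWithKernel (fun p ω => c * H (f p) ω)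
      (fun p q => c ^ 2 * K (f p) (f q)) μ where
  gaussian := (hH.gaussian.comp_right f).smul fun _ => c
  mean_zero p := by rw [integral_const_mul, hH.mean_zero, mul_zero]
  covariance_eq p q := by
    rw [covariance_const_mul_left, covariance_const_mul_right, hH.covariance_eq]
    ring
  continuous_paths := hH.continuous_paths.mono fun ω hω => (hω.comp hf).const_mul c

lemma IndepProcesses.const_mul_comp {H₁ H₂ : BoxIndex d → Ω → ℝ} (hH : IndepProcesses H₁ H₂ μ)
    (c : ℝ) (f : BoxIndex d → BoxIndex d) :
    IndepProcesses (fun p ω => c * H₁ (f p) ω) (fun p ω => c * H₂ (f p) ω) μ :=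
  have hm : Measurable fun (h : BoxIndex d → ℝ) p => c * h (f p) := by fun_prop
  IndepFun.comp hH hm hm

/-- The law of `supInf` of a field that is determined by the sum of two independent centered
Gaussian processes only depends on the covariance kernel of these. -/
theorem identDistrib_supInf [IsProbabilityMeasure μ] [IsProbabilityMeasure ν]
    {Θ : BoxIndex d → ℝ → ℝ} (hΘ : ∀ p, Measurable (Θ p))
    (hΘc : ∀ h : BoxIndex d → ℝ, Continuous h →
      ContinuousOn (fun p => Θ p (h p)) (admissiblePairs d))
    {X₁ X₂ : BoxIndex d → Ω → ℝ} {Y₁ Y₂ : BoxIndex d → Ω' → ℝ}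
    (hX₁ : IsCenteredGaussianWithKernel X₁ K μ) (hX₂ : IsCenteredGaussianWithKernel X₂ K μ)
    (hX : IndepProcesses X₁ X₂ μ)
    (hY₁ : IsCenteredGaussianWithKernel Y₁ K ν) (hY₂ : IsCenteredGaussianWithKernel Y₂ K ν)
    (hY : IndepProcesses Y₁ Y₂ ν) :
    IdentDistrib (fun ω => supInf fun u v => Θ (u, v) (X₁ (u, v) ω + X₂ (u, v) ω))
      (fun ω => supInf fun u v => Θ (u, v) (Y₁ (u, v) ω + Y₂ (u, v) ω)) μ ν := by
  obtain ⟨C, hC, Φ, hΦ, hsup⟩ := exists_measurable_supInf hΘ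
  have := hC.to_subtype
  have hm : Measurable fun (h : BoxIndex d → ℝ) (p : C) => h p := by fun_prop
  have hlaw {X : BoxIndex d → Ω → ℝ} {Y : BoxIndex d → Ω' → ℝ}
      (hX : IsCenteredGaussianWithKernel X K μ) (hY : IsCenteredGaussianWithKernel Y K ν) :
      μ.map (fun ω (p : C) => X p ω) = ν.map (fun ω (p : C) => Y p ω) :=
    map_eq_of_isGaussianProcess (hX.gaussian.restrict C) (hY.gaussian.restrict C)
      (fun p => by rw [hX.mean_zero, hY.mean_zero])
      (fun p q => by rw [hX.covariance_eq, hY.covariance_eq])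
  have hmX {X : BoxIndex d → Ω → ℝ} (hX : IsCenteredGaussianWithKernel X K μ) :
      AEMeasurable (fun ω (p : C) => X p ω) μ :=
    aemeasurable_pi_lambda _ fun p => hX.gaussian.aemeasurable p
  have hmY {Y : BoxIndex d → Ω' → ℝ} (hY : IsCenteredGaussianWithKernel Y K ν) :
      AEMeasurable (fun ω (p : C) => Y p ω) ν :=
    aemeasurable_pi_lambda _ fun p => hY.gaussian.aemeasurable p
  have hΦid := (map_add_eq_of_indepFun (hmX hX₁) (hmX hX₂) (hmY hY₁) (hmY hY₂)
    (IndepFun.comp hX hm hm) (IndepFun.comp hY hm hm) (hlaw hX₁ hY₁) (hlaw hX₂ hY₂)).comp hΦ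
  refine ((IdentDistrib.of_ae_eq hΦid.aemeasurable_fst ?_).symm.trans hΦid).trans
    (IdentDistrib.of_ae_eq hΦid.aemeasurable_snd ?_)
  · filter_upwards [hX₁.continuous_paths, hX₂.continuous_paths] with ω h₁ h₂
    exact (hsup _ (hΘc _ (h₁.add h₂))).symm
  · filter_upwards [hY₁.continuous_paths, hY₂.continuous_paths] with ω h₁ h₂
    exact (hsup _ (hΘc _ (h₁.add h₂))).symm

/-- The analogue of `identDistrib_supInf` for `infSup`, which is obtained from it by a change of
sign and an exchange of the two variables. -/
theorem identDistrib_infSup [IsProbabilityMeasure μ] [IsProbabilityMeasure ν]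
    {Θ : BoxIndex d → ℝ → ℝ} (hΘ : ∀ p, Measurable (Θ p))
    (hΘc : ∀ h : BoxIndex d → ℝ, Continuous h →
      ContinuousOn (fun p => Θ p (h p)) (admissiblePairs d))
    {X₁ X₂ : BoxIndex d → Ω → ℝ} {Y₁ Y₂ : BoxIndex d → Ω' → ℝ}
    (hX₁ : IsCenteredGaussianWithKernel X₁ K μ) (hX₂ : IsCenteredGaussianWithKernel X₂ K μ)
    (hX : IndepProcesses X₁ X₂ μ)
    (hY₁ : IsCenteredGaussianWithKernel Y₁ K ν) (hY₂ : IsCenteredGaussianWithKernel Y₂ K ν)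
    (hY : IndepProcesses Y₁ Y₂ ν) :
    IdentDistrib (fun ω => infSup fun u v => Θ (u, v) (X₁ (u, v) ω + X₂ (u, v) ω))
      (fun ω => infSup fun u v => Θ (u, v) (Y₁ (u, v) ω + Y₂ (u, v) ω)) μ ν := by
  have hswap : MapsTo Prod.swap (admissiblePairs d) (admissiblePairs d) :=
    fun p hp k => by simpa [add_comm] using hp k
  have hΘ' (h : BoxIndex d → ℝ) (hc : Continuous h) :
      ContinuousOn (fun p : BoxIndex d => -Θ p.swap (h p)) (admissiblePairs d) := by
    have := (hΘc _ (hc.comp continuous_swap)).comp continuous_swap.continuousOn hswap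
    exact this.neg
  have key := identDistrib_supInf (Θ := fun p x => -Θ p.swap x) (fun p => (hΘ _).neg) hΘ'
    (hX₁.const_mul_comp 1 continuous_swap) (hX₂.const_mul_comp 1 continuous_swap)
    (hX.const_mul_comp 1 Prod.swap)
    (hY₁.const_mul_comp 1 continuous_swap) (hY₂.const_mul_comp 1 continuous_swap)
    (hY.const_mul_comp 1 Prod.swap)
  simpa [infSup_eq_neg_supInf, Function.comp_def] using key.comp (measurable_neg (G := EReal))

end Processes

/-! ### The scaling argument -/

/-- The drift of `driftedField` with unit coefficients. -/
noncomputable def unitDrift {d : ℕ} (s : ℕ) (β : Fin d → ℕ) (p : BoxIndex d) : ℝ :=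
  ∑ k ∈ firstCoords d s,
    (((p.2 k : ℝ) ^ (β k + 1) - (-(p.1 k : ℝ)) ^ (β k + 1)) / ((p.1 k : ℝ) + (p.2 k : ℝ)))

section Scaling

variable {d s : ℕ} {β : Fin d → ℕ} {σ A κ : ℝ} {a : Fin d → ℝ} {c : Fin d → ℝ≥0}
  {D D' : (Fin d → ℝ≥0) → (Fin d → ℝ≥0) → ℝ}

lemma driftedField_one (h₁ h₂ : BoxIndex d → ℝ) (u v : Fin d → ℝ≥0) :
    driftedField s β 1 (fun _ => 1) D h₁ h₂ u v =
      (h₁ (u, v) + h₂ (u, v)) / ((∏ k ∈ firstCoords d s, ((u k : ℝ) + (v k : ℝ))) * D u v)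
        + unitDrift s β (u, v) := by
  simp only [driftedField, unitDrift, one_mul, add_div]

/-- The effect of the rescaling `(u, v) ↦ (c u, c v)` on the field. -/
lemma driftedField_scale (hc : ∀ k, 0 < c k) (hκ : 0 < κ)
    (hD : ∀ u v, D (c * u) (c * v) = κ * D' u v)
    (ha : ∀ k ∈ firstCoords d s, a k * (c k : ℝ) ^ β k = A)
    (hA : 0 < A) (hσ : 0 < σ) (hσA : σ ^ 2 = A ^ 2 * (κ * ∏ k ∈ firstCoords d s, (c k : ℝ)))
    (h₁ h₂ : BoxIndex d → ℝ) (u v : Fin d → ℝ≥0) :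
    driftedField s β σ a D h₁ h₂ (c * u) (c * v) =
      A * driftedField s β 1 (fun _ => 1) D'
        (fun p => (√(κ * ∏ k ∈ firstCoords d s, (c k : ℝ)))⁻¹ * h₁ (c * p.1, c * p.2))
        (fun p => (√(κ * ∏ k ∈ firstCoords d s, (c k : ℝ)))⁻¹ * h₂ (c * p.1, c * p.2)) u v := by
  have hc' (k : Fin d) : (0 : ℝ) < c k := hc k
  set m : ℝ := κ * ∏ k ∈ firstCoords d s, (c k : ℝ) with hm
  have hmpos : 0 < m := mul_pos hκ (Finset.prod_pos fun k _ => hc' k)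
  have hσm : σ = A * √m := by
    rw [← Real.sqrt_sq hσ.le, hσA, Real.sqrt_mul (sq_nonneg A), Real.sqrt_sq hA.le]
  have hden : (∏ k ∈ firstCoords d s, ((((c * u) k : ℝ≥0) : ℝ) + (((c * v) k : ℝ≥0) : ℝ))) *
      D (c * u) (c * v) =
        m * ((∏ k ∈ firstCoords d s, ((u k : ℝ) + (v k : ℝ))) * D' u v) := by
    simp only [Pi.mul_apply, NNReal.coe_mul, ← mul_add, Finset.prod_mul_distrib, hD, hm]
    ring
  have hdrift : ∑ k ∈ firstCoords d s, a k * (((((c * v) k : ℝ≥0) : ℝ) ^ (β k + 1) -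
        (-(((c * u) k : ℝ≥0) : ℝ)) ^ (β k + 1)) /
          ((((c * u) k : ℝ≥0) : ℝ) + (((c * v) k : ℝ≥0) : ℝ))) =
      A * unitDrift s β (u, v) := by
    rw [unitDrift, Finset.mul_sum]
    refine Finset.sum_congr rfl fun k hk => ?_
    rw [← ha k hk]
    simp only [Pi.mul_apply, NNReal.coe_mul, ← mul_add, ← mul_neg, mul_pow, ← mul_sub]
    rw [pow_succ, mul_comm _ (c k : ℝ), mul_assoc (c k : ℝ), mul_div_mul_left _ _ (hc' k).ne',
      mul_div_assoc, mul_assoc]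
  have hfrac (x y : ℝ) : σ * x / (m * y) = A * ((√m)⁻¹ * x / y) := by
    have h0 : √m ≠ 0 := (Real.sqrt_pos.2 hmpos).ne'
    have hσ' : σ * x = m * (A * ((√m)⁻¹ * x)) := by
      rw [hσm]
      nth_rw 2 [← Real.mul_self_sqrt hmpos.le]
      field_simp
    rw [hσ', mul_div_mul_left _ _ hmpos.ne', mul_div_assoc]
  rw [driftedField_one, driftedField, hdrift, hden, hfrac, hfrac]
  ring

lemma continuousOn_unitDrift : ContinuousOn (unitDrift s β) (admissiblePairs d) := by
  refine continuousOn_finsetSum _ fun k _ => ?_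
  have hnum : Continuous fun p : BoxIndex d =>
      (p.2 k : ℝ) ^ (β k + 1) - (-(p.1 k : ℝ)) ^ (β k + 1) := by fun_prop
  have hden : Continuous fun p : BoxIndex d => (p.1 k : ℝ) + (p.2 k : ℝ) := by fun_prop
  refine hnum.continuousOn.div hden.continuousOn fun p hp => ?_
  have : (0 : ℝ) < p.1 k + p.2 k := by exact_mod_cast hp k
  exact this.ne'

/-- If the rescaling by `c` multiplies `D` by a constant and the kernel by the matching constant,
and if `A` is the common value of the coefficients after the rescaling, then the functionals of
the original field are distributed like `A` times those of the standardized field. -/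
theorem identDistrib_of_scaling {Ω Ω' : Type*} [MeasurableSpace Ω] [MeasurableSpace Ω']
    {μ : Measure Ω} {ν : Measure Ω'} [IsProbabilityMeasure μ] [IsProbabilityMeasure ν]
    {K K' : BoxIndex d → BoxIndex d → ℝ} (hc : ∀ k, 0 < c k) (hκ : 0 < κ)
    (hD : ∀ u v, D (c * u) (c * v) = κ * D' u v)
    (hD'c : Continuous fun p : BoxIndex d => D' p.1 p.2)
    (hD'pos : ∀ p ∈ admissiblePairs d, 0 < D' p.1 p.2)
    (hK : ∀ p q, K (c * p.1, c * p.2) (c * q.1, c * q.2) =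
      (κ * ∏ k ∈ firstCoords d s, (c k : ℝ)) * K' p q)
    (ha : ∀ k ∈ firstCoords d s, a k * (c k : ℝ) ^ β k = A)
    (hA : 0 < A) (hσ : 0 < σ) (hσA : σ ^ 2 = A ^ 2 * (κ * ∏ k ∈ firstCoords d s, (c k : ℝ)))
    {H₁ H₂ : BoxIndex d → Ω → ℝ} {G₁ G₂ : BoxIndex d → Ω' → ℝ}
    (hH₁ : IsCenteredGaussianWithKernel H₁ K μ) (hH₂ : IsCenteredGaussianWithKernel H₂ K μ)
    (hH : IndepProcesses H₁ H₂ μ)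
    (hG₁ : IsCenteredGaussianWithKernel G₁ K' ν) (hG₂ : IsCenteredGaussianWithKernel G₂ K' ν)
    (hG : IndepProcesses G₁ G₂ ν) :
    IdentDistrib
        (fun ω => supInf (driftedField s β σ a D (fun p => H₁ p ω) (fun p => H₂ p ω)))
        (fun ω => (A : EReal) *
          supInf (driftedField s β 1 (fun _ => 1) D' (fun p => G₁ p ω) (fun p => G₂ p ω))) μ ν ∧
      IdentDistrib
        (fun ω => infSup (driftedField s β σ a D (fun p => H₁ p ω) (fun p => H₂ p ω)))
        (fun ω => (A : EReal) *
          infSup (driftedField s β 1 (fun _ => 1) D' (fun p => G₁ p ω) (fun p => G₂ p ω)))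
        μ ν := by
  set m : ℝ := κ * ∏ k ∈ firstCoords d s, (c k : ℝ) with hm
  have hmpos : 0 < m := mul_pos hκ (Finset.prod_pos fun k _ => hc k)
  let Θ : BoxIndex d → ℝ → ℝ := fun p x =>
    A * (x / ((∏ k ∈ firstCoords d s, ((p.1 k : ℝ) + (p.2 k : ℝ))) * D' p.1 p.2)
      + unitDrift s β p)
  have hΘ (p : BoxIndex d) : Measurable (Θ p) := by fun_prop
  have hΘc (h : BoxIndex d → ℝ) (hh : Continuous h) :
      ContinuousOn (fun p => Θ p (h p)) (admissiblePairs d) := by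
    have hden : Continuous fun p : BoxIndex d =>
        (∏ k ∈ firstCoords d s, ((p.1 k : ℝ) + (p.2 k : ℝ))) * D' p.1 p.2 :=
      Continuous.mul (by fun_prop) hD'c
    have hne (p : BoxIndex d) (hp : p ∈ admissiblePairs d) :
        (∏ k ∈ firstCoords d s, ((p.1 k : ℝ) + (p.2 k : ℝ))) * D' p.1 p.2 ≠ 0 := by
      refine (mul_pos (Finset.prod_pos fun k _ => ?_) (hD'pos p hp)).ne'
      exact_mod_cast hp k
    exact continuousOn_const.mul ((hh.continuousOn.div hden.continuousOn hne).add
      continuousOn_unitDrift)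
  have hf : Continuous fun p : BoxIndex d => ((c * p.1, c * p.2) : BoxIndex d) := by fun_prop
  have hscale {H : BoxIndex d → Ω → ℝ} (hH : IsCenteredGaussianWithKernel H K μ) :
      IsCenteredGaussianWithKernel (fun p ω => (√m)⁻¹ * H (c * p.1, c * p.2) ω) K' μ := by
    convert hH.const_mul_comp (√m)⁻¹ hf using 3 with p q
    rw [hK, inv_pow, Real.sq_sqrt hmpos.le, inv_mul_cancel_left₀ hmpos.ne']
  have hfield (ω : Ω) : (fun u v => driftedField s β σ a D (fun p => H₁ p ω) (fun p => H₂ p ω)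
      (c * u) (c * v)) = fun u v => Θ (u, v) ((√m)⁻¹ * H₁ (c * u, c * v) ω +
        (√m)⁻¹ * H₂ (c * u, c * v) ω) := by
    funext u v
    rw [driftedField_scale hc hκ hD ha hA hσ hσA, driftedField_one]
  have hfield' (ω : Ω') : (fun u v => A * driftedField s β 1 (fun _ => 1) D' (fun p => G₁ p ω)
      (fun p => G₂ p ω) u v) = fun u v => Θ (u, v) (G₁ (u, v) ω + G₂ (u, v) ω) := by
    funext u v
    rw [driftedField_one]
  have hind : IndepProcesses (fun p ω => (√m)⁻¹ * H₁ (c * p.1, c * p.2) ω)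
      (fun p ω => (√m)⁻¹ * H₂ (c * p.1, c * p.2) ω) μ :=
    hH.const_mul_comp (√m)⁻¹ fun p => (c * p.1, c * p.2)
  have hX₁ := hscale hH₁
  have hX₂ := hscale hH₂
  clear_value Θ
  constructor
  · have hl (ω : Ω) := (supInf_scale hc
      (driftedField s β σ a D (fun p => H₁ p ω) (fun p => H₂ p ω))).trans
        (congrArg supInf (hfield ω))
    have hr (ω : Ω') := (mul_supInf hA (driftedField s β 1 (fun _ => 1) D' (fun p => G₁ p ω)
      (fun p => G₂ p ω))).trans (congrArg supInf (hfield' ω))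
    rw [funext hl, funext hr]
    have key := identDistrib_supInf hΘ hΘc hX₁ hX₂ hind hG₁ hG₂ hG
    exact key
  · have hl (ω : Ω) := (infSup_scale hc
      (driftedField s β σ a D (fun p => H₁ p ω) (fun p => H₂ p ω))).trans
        (congrArg infSup (hfield ω))
    have hr (ω : Ω') := (mul_infSup hA (driftedField s β 1 (fun _ => 1) D' (fun p => G₁ p ω)
      (fun p => G₂ p ω))).trans (congrArg infSup (hfield' ω))
    rw [funext hl, funext hr]
    have key := identDistrib_infSup hΘ hΘc hX₁ hX₂ hind hG₁ hG₂ hG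
    exact key

/-- The scale factors `c_k = (A / a_k)^{1/β_k}`, for `A` the constant `scaleConst s β q a`. -/
theorem exists_scale_factors (hβ : ∀ k ∈ firstCoords d s, 1 ≤ β k)
    (ha : ∀ k ∈ firstCoords d s, 0 < a k) {q : ℝ} (hq : 0 < q) :
    0 < scaleConst s β q a ∧ ∃ c : Fin d → ℝ≥0, (∀ k, 0 < c k) ∧
      (∀ k : Fin d, s ≤ (k : ℕ) → c k = 1) ∧
      (∀ k ∈ firstCoords d s, a k * (c k : ℝ) ^ β k = scaleConst s β q a) ∧
      scaleConst s β q a ^ 2 * ∏ k ∈ firstCoords d s, (c k : ℝ) = q := by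
  set P : ℝ := ∏ k ∈ firstCoords d s, (a k) ^ (1 / (β k : ℝ)) with hP
  set t : ℝ := ∑ k ∈ firstCoords d s, (β k : ℝ)⁻¹ with ht
  have hPpos : 0 < P := Finset.prod_pos fun k hk => Real.rpow_pos_of_pos (ha k hk) _
  have htnn : 0 ≤ t := Finset.sum_nonneg fun k _ => by positivity
  set A : ℝ := scaleConst s β q a with hAdef
  have hA : 0 < A := Real.rpow_pos_of_pos (mul_pos hq hPpos) _
  have hpow : A ^ (2 + t) = q * P := by
    rw [hAdef, scaleConst, ← hP, ← ht, ← Real.rpow_mul (mul_pos hq hPpos).le, one_div,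
      inv_mul_cancel₀ (by positivity), Real.rpow_one]
  have hmem (k : Fin d) : k ∈ firstCoords d s ↔ (k : ℕ) < s := by simp [firstCoords]
  refine ⟨hA, fun k => if (k : ℕ) < s then ((A / a k) ^ (1 / (β k : ℝ))).toNNReal else 1,
    fun k => ?_, fun k hk => if_neg (not_lt.2 hk), fun k hk => ?_, ?_⟩
  · dsimp only
    split_ifs with hk
    · exact Real.toNNReal_pos.2 (Real.rpow_pos_of_pos (div_pos hA (ha k ((hmem k).2 hk))) _)
    · exact one_pos
  · have hdiv := div_pos hA (ha k hk)
    have hβk : (β k : ℝ) ≠ 0 := Nat.cast_ne_zero.2 (by have := hβ k hk; omega)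
    dsimp only
    rw [if_pos ((hmem k).1 hk), Real.coe_toNNReal _ (Real.rpow_nonneg hdiv.le _),
      ← Real.rpow_natCast, ← Real.rpow_mul hdiv.le, one_div_mul_cancel hβk, Real.rpow_one,
      mul_div_cancel₀ _ (ha k hk).ne']
  · have hprod : ∏ k ∈ firstCoords d s,
        (((if (k : ℕ) < s then ((A / a k) ^ (1 / (β k : ℝ))).toNNReal else 1 : ℝ≥0)) : ℝ) =
          A ^ t / P := by
      rw [ht, Real.rpow_sum_of_pos hA, hP, ← Finset.prod_div_distrib]
      refine Finset.prod_congr rfl fun k hk => ?_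
      rw [if_pos ((hmem k).1 hk), Real.coe_toNNReal _
        (Real.rpow_nonneg (div_pos hA (ha k hk)).le _), Real.div_rpow hA.le (ha k hk).le, one_div]
    rw [hprod, ← mul_div_assoc, ← Real.rpow_two, ← Real.rpow_add hA, hpow,
      mul_div_cancel_right₀ _ hPpos.ne']

lemma min_mul_add_min_mul (r x x' y y' : ℝ≥0) :
    (min ((r * x : ℝ≥0) : ℝ) (r * x' : ℝ≥0) + min ((r * y : ℝ≥0) : ℝ) (r * y' : ℝ≥0) : ℝ) =
      r * (min (x : ℝ) x' + min (y : ℝ) y') := by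
  simp only [NNReal.coe_mul, mul_add, mul_min_of_nonneg _ _ r.coe_nonneg]

lemma sliceMass_scale {g : (Fin d → ℝ) → ℝ} {x₀ : Fin d → ℝ}
    (hc : ∀ k : Fin d, s ≤ (k : ℕ) → c k = 1) (u v : Fin d → ℝ≥0) :
    sliceMass g x₀ s (c * u) (c * v) = sliceMass g x₀ s u v :=
  sliceMass_congr (fun k hk => by simp [hc k hk]) (fun k hk => by simp [hc k hk])

lemma sliceKernel_scale {g : (Fin d → ℝ) → ℝ} {x₀ : Fin d → ℝ}
    (hc : ∀ k : Fin d, s ≤ (k : ℕ) → c k = 1) (p q : BoxIndex d) :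
    sliceKernel g x₀ s (c * p.1, c * p.2) (c * q.1, c * q.2) =
      (∏ k ∈ firstCoords d s, (c k : ℝ)) * sliceKernel g x₀ s p q := by
  have hD : sliceMass g x₀ s ((c * p.1) ⊓ (c * q.1)) ((c * p.2) ⊓ (c * q.2)) =
      sliceMass g x₀ s (p.1 ⊓ q.1) (p.2 ⊓ q.2) :=
    sliceMass_congr (fun k hk => by simp [hc k hk]) (fun k hk => by simp [hc k hk])
  simp only [sliceKernel, hD, Pi.mul_apply, min_mul_add_min_mul, Finset.prod_mul_distrib,
    mul_assoc]

lemma firstCoords_self : firstCoords d d = Finset.univ := by simp [firstCoords]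

lemma sliceKernel_self {g : (Fin d → ℝ) → ℝ} {x₀ : Fin d → ℝ} (p q : BoxIndex d) :
    sliceKernel g x₀ d p q = g x₀ * standardKernel p q := by
  rw [sliceKernel, sliceMass_self, firstCoords_self, standardKernel, mul_comm]

end Scaling

/-! ### Equality in law of the limits -/

theorem proposition4p2
    {d : ℕ} (s : ℕ) (hs : s ≤ d)
    -- the regression function and the point of interest
    (f₀ : (Fin d → ℝ) → ℝ) (hf₀ : MonotoneOn f₀ (Icc (0 : Fin d → ℝ) 1))
    (x₀ : Fin d → ℝ) (hx₀ : ∀ k, x₀ k ∈ Ioo (0 : ℝ) 1)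
    (β : Fin d → ℕ)
    (hβ : ∀ k : Fin d, (k : ℕ) < s → firstDerivOrder f₀ x₀ k = (β k : ℕ∞))
    (hdiff : ∀ k : Fin d, (k : ℕ) < s → HasPartialDerivAt f₀ x₀ k (β k))
    (hβ_top : ∀ k : Fin d, s ≤ (k : ℕ) → firstDerivOrder f₀ x₀ k = ⊤)
    -- `L* = {β_k e_k : 1 ≤ k ≤ s}`
    (hL : multiIndexLstar s β =
      {l | ∃ k : Fin d, (k : ℕ) < s ∧ l = Pi.single k (β k)})
    -- the density of the predictor and the standard deviation of the errors
    (g : (Fin d → ℝ) → ℝ) (hg : IsPredictorDensity g x₀ s)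
    (σ₀ : ℝ) (hσ₀ : 0 < σ₀)
    -- the processes `H₁`, `H₂`
    {Ω : Type*} [MeasurableSpace Ω] (μ : Measure Ω) [IsProbabilityMeasure μ]
    (H₁ H₂ : BoxIndex d → Ω → ℝ)
    (hH₁ : IsCenteredGaussianWithKernel H₁ (sliceKernel g x₀ s) μ)
    (hH₂ : IsCenteredGaussianWithKernel H₂ (sliceKernel g x₀ s) μ)
    (hH : IndepProcesses H₁ H₂ μ) :
    (IdentDistrib
        (fun ω => supInf (driftedField s β σ₀ (driftCoeff f₀ x₀ β) (sliceMass g x₀ s)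
          (fun p => H₁ p ω) (fun p => H₂ p ω)))
        (fun ω => (scaleConst s β (σ₀ ^ 2) (driftCoeff f₀ x₀ β) : EReal) *
          supInf (driftedField s β 1 (fun _ => 1) (sliceMass g x₀ s)
            (fun p => H₁ p ω) (fun p => H₂ p ω)))
        μ μ ∧
      IdentDistrib
        (fun ω => infSup (driftedField s β σ₀ (driftCoeff f₀ x₀ β) (sliceMass g x₀ s)
          (fun p => H₁ p ω) (fun p => H₂ p ω)))
        (fun ω => (scaleConst s β (σ₀ ^ 2) (driftCoeff f₀ x₀ β) : EReal) *
          infSup (driftedField s β 1 (fun _ => 1) (sliceMass g x₀ s)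
            (fun p => H₁ p ω) (fun p => H₂ p ω)))
        μ μ) ∧
    (s = d →
      ∀ {Ω' : Type*} [MeasurableSpace Ω'] (μ' : Measure Ω') [IsProbabilityMeasure μ']
        (G₁ G₂ : BoxIndex d → Ω' → ℝ),
        IsCenteredGaussianWithKernel G₁ standardKernel μ' →
        IsCenteredGaussianWithKernel G₂ standardKernel μ' →
        IndepProcesses G₁ G₂ μ' →
        IdentDistrib
          (fun ω => supInf (driftedField s β σ₀ (driftCoeff f₀ x₀ β) (sliceMass g x₀ s)
            (fun p => H₁ p ω) (fun p => H₂ p ω)))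
          (fun ω => (scaleConst d β (σ₀ ^ 2 / g x₀) (driftCoeff f₀ x₀ β) : EReal) *
            supInf (driftedField d β 1 (fun _ => 1) (fun _ _ => 1)
              (fun p => G₁ p ω) (fun p => G₂ p ω)))
          μ μ' ∧
        IdentDistrib
          (fun ω => infSup (driftedField s β σ₀ (driftCoeff f₀ x₀ β) (sliceMass g x₀ s)
            (fun p => H₁ p ω) (fun p => H₂ p ω)))
          (fun ω => (scaleConst d β (σ₀ ^ 2 / g x₀) (driftCoeff f₀ x₀ β) : EReal) *
            infSup (driftedField d β 1 (fun _ => 1) (fun _ _ => 1)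
              (fun p => G₁ p ω) (fun p => G₂ p ω)))
          μ μ') := by
  have hmem (k : Fin d) (hk : k ∈ firstCoords d s) : (k : ℕ) < s := by
    simpa [firstCoords] using hk
  have ha (k : Fin d) (hk : k ∈ firstCoords d s) : 0 < driftCoeff f₀ x₀ β k :=
    div_pos (partialDerivAt_pos hf₀ hx₀ (hβ k (hmem k hk)) (hdiff k (hmem k hk))) (by positivity)
  have hβ1 (k : Fin d) (hk : k ∈ firstCoords d s) : 1 ≤ β k :=
    (one_le_and_partialDerivAt_ne_zero (hβ k (hmem k hk))).1
  constructor
  -- the rescaling leaves the integrated coordinates alone, so that `D_s` is unchanged (`κ = 1`)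
  · obtain ⟨hA, c, hc, hc1, hca, hcA⟩ := exists_scale_factors hβ1 ha (pow_pos hσ₀ 2)
    exact identDistrib_of_scaling hc one_pos (fun u v => by rw [sliceMass_scale hc1, one_mul])
      (continuous_sliceMass hx₀ hg) (fun p hp => sliceMass_pos hx₀ hg hp)
      (fun p q => by rw [sliceKernel_scale hc1, one_mul]) hca hA hσ₀ (by rw [one_mul, hcA])
      hH₁ hH₂ hH hH₁ hH₂ hH
  · rintro rfl Ω' _ μ' _ G₁ G₂ hG₁ hG₂ hG
    have hgx : 0 < g x₀ := by
      obtain ⟨a₁, a₂, ha₁, hb⟩ := hg.bounded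
      exact ha₁.trans_le (hb x₀ ⟨fun k => (hx₀ k).1.le, fun k => (hx₀ k).2.le⟩).1
    obtain ⟨hA, c, hc, hc1, hca, hcA⟩ := exists_scale_factors hβ1 ha
      (div_pos (pow_pos hσ₀ 2) hgx)
    -- for `s = d` the rescaling is combined with `D_d = g x₀ · 1`, that is `κ = g x₀`
    refine identDistrib_of_scaling hc hgx (fun u v => by rw [sliceMass_self, mul_one])
      continuous_const (fun _ _ => one_pos)
      (fun p q => by rw [sliceKernel_scale hc1, sliceKernel_self]; ring) hca hA hσ₀ ?_
      hH₁ hH₂ hH hG₁ hG₂ hG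
    rw [mul_left_comm, hcA, mul_div_cancel₀ _ hgx.ne']
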